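/- Let $M$ be a smooth $n$-dimensional manifold, possibly with boundary (or corners), let $J\subset\mathbb R$ be a nondegenerate interval, and let $F:M\times J\to\mathbb R^{n+1}$ be a smooth map such that every $F_t=F(\cdot,t)$ is an immersion, with a smooth choice $\nu:M\times J\to\mathbb R^{n+1}$ of unit normals, $|\nu|=1$ and $\nu(p,t)\perp dF_t(T_pM)$. In local coordinates on $M$ write $g_{ij}=\langle\partial_iF_t,\partial_jF_t\rangle$ for the induced metric, $h_{ij}=\langle\partial_i\nu,\partial_jF_t\rangle$ for the second fundamental form $A$, $H=g^{ij}h_{ij}$ for the mean curvature, $|A|^2=g^{ik}g^{jl}h_{ij}h_{kl}$, and $\Delta_{M_t}$ for the Laplace–Beltrami operator of $g$. Suppose that $F$ is a mean curvature flow, that is, $$\frac{\partial F}{\partial t}=-H\,\nu\qquad\text{on } M\times J .$$ For $i=1,\dots,n$ let $K_i(x)=x_{n+1}e_i-x_ie_{n+1}$ be the rotational Killing fields of $\mathbb R^{n+1}$, where $e_1,\dots,e_{n+1}$ is the standard basis, and put $s_i(p,t)=\langle \nu(p,t),K_i(F(p,t))\rangle$. Then each $s_i$ is differentiable in $t$ and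 satisfies $$\Big(\frac{\partial}{\partial t}-\Delta_{M_t}\Big)s_i=|A|^2\,s_i\qquad\text{on } M\times J .$$ (Derivatives at boundary points of $M$ and at endpoints of $J$ belonging to $J$ are one-sided.) -/

import Mathlib

open Set Matrix
open scoped Manifold ContDiff InnerProductSpace

noncomputable section

namespace MCF

variable {n : ℕ} {H : Type*} [TopologicalSpace H]
  (I : ModelWithCorners ℝ (EuclideanSpace ℝ (Fin n)) H)

/-- Partial derivative `∂ᵢ f` of a function of the local coordinates `x = (x₁, …, xₙ)`.  Coordinate
domains are relatively open subsets of `range I` (all of `ℝⁿ` without boundary, a half-space with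
boundary), so that derivatives at boundary points are one-sided. -/
def partialDeriv {V : Type*} [NormedAddCommGroup V] [NormedSpace ℝ V]
    (i : Fin n) (f : EuclideanSpace ℝ (Fin n) → V) (x : EuclideanSpace ℝ (Fin n)) : V :=
  fderivWithin ℝ f (range I) x (EuclideanSpace.single i (1 : ℝ))

/-- Coefficients `gᵢⱼ = ⟨∂ᵢX, ∂ⱼX⟩` of the metric induced by a local parametrisation `X`. -/
def metric (X : EuclideanSpace ℝ (Fin n) → EuclideanSpace ℝ (Fin (n + 1)))
    (x : EuclideanSpace ℝ (Fin n)) : Matrix (Fin n) (Fin n) ℝ :=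
  Matrix.of fun i j => ⟪partialDeriv I i X x, partialDeriv I j X x⟫_ℝ

/-- Coefficients `hᵢⱼ = ⟨∂ᵢN, ∂ⱼX⟩` of the second fundamental form of a local parametrisation `X`
with unit normal `N`, so that `∂ᵢN = ∑ hᵢⱼ gʲᵏ ∂ₖX`.  Round spheres with outward
normal have a positive definite second fundamental form. -/
def secondFundamentalForm
    (X N : EuclideanSpace ℝ (Fin n) → EuclideanSpace ℝ (Fin (n + 1)))
    (x : EuclideanSpace ℝ (Fin n)) : Matrix (Fin n) (Fin n) ℝ :=
  Matrix.of fun i j => ⟪partialDeriv I i N x, partialDeriv I j X x⟫_ℝ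

/-- Christoffel symbols `Γᵏᵢⱼ = ½ ∑ₗ gᵏˡ (∂ᵢ gⱼₗ + ∂ⱼ gᵢₗ - ∂ₗ gᵢⱼ)` of the induced metric. -/
def christoffel (X : EuclideanSpace ℝ (Fin n) → EuclideanSpace ℝ (Fin (n + 1)))
    (k i j : Fin n) (x : EuclideanSpace ℝ (Fin n)) : ℝ :=
  (1 / 2) * ∑ l, (metric I X x)⁻¹ k l *
    (partialDeriv I i (fun y => metric I X y j l) x
      + partialDeriv I j (fun y => metric I X y i l) x
      - partialDeriv I l (fun y => metric I X y i j) x)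

variable {M : Type*} [TopologicalSpace M] [ChartedSpace H M]

/-- Expression of a function on `M` in the coordinates of the preferred chart around `p`. -/
def inCoords {V : Type*} (p : M) (f : M → V) : EuclideanSpace ℝ (Fin n) → V :=
  f ∘ (extChartAt I p).symm

/-- Mean curvature `H = ∑ gⁱʲ hᵢⱼ` at `p` of an immersion `f` with unit normal `ν`. -/
def meanCurvature (f ν : M → EuclideanSpace ℝ (Fin (n + 1))) (p : M) : ℝ :=
  let x := extChartAt I p p
  let g := metric I (inCoords I p f) x
  let h := secondFundamentalForm I (inCoords I p f) (inCoords I p ν) x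
  ∑ i, ∑ j, g⁻¹ i j * h i j

/-- Squared norm `|A|² = ∑ gⁱᵏ gʲˡ hᵢⱼ hₖₗ` at `p` of the second fundamental form of an
immersion `f` with unit normal `ν`. -/
def normSqSecondFundamentalForm (f ν : M → EuclideanSpace ℝ (Fin (n + 1))) (p : M) : ℝ :=
  let x := extChartAt I p p
  let g := metric I (inCoords I p f) x
  let h := secondFundamentalForm I (inCoords I p f) (inCoords I p ν) x
  ∑ i, ∑ j, ∑ k, ∑ l, g⁻¹ i k * g⁻¹ j l * h i j * h k l

/-- Laplace-Beltrami operator `Δu = ∑ gⁱʲ (∂ᵢ∂ⱼu - ∑ Γᵏᵢⱼ ∂ₖu)` at `p`, for the metric on `M`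
induced by the immersion `f`. -/
def laplaceBeltrami (f : M → EuclideanSpace ℝ (Fin (n + 1))) (u : M → ℝ) (p : M) : ℝ :=
  let x := extChartAt I p p
  let X := inCoords I p f
  let w := inCoords I p u
  ∑ i, ∑ j, (metric I X x)⁻¹ i j *
    (partialDeriv I i (partialDeriv I j w) x - ∑ k, christoffel I X k i j x * partialDeriv I k w x)

/-- `F : M × J → ℝⁿ⁺¹` is a smooth one-parameter family of immersed hypersurfaces with smooth unit
normals `ν`, moving by mean curvature: `∂F/∂t = -H ν`.  At an endpoint of `J` belonging to `J`, time
derivatives are one-sided. -/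
structure IsMeanCurvatureFlow (J : Set ℝ) (F ν : ℝ → M → EuclideanSpace ℝ (Fin (n + 1))) :
    Prop where
  smooth : ContMDiffOn (I.prod 𝓘(ℝ, ℝ)) 𝓘(ℝ, EuclideanSpace ℝ (Fin (n + 1))) ∞
    (fun q : M × ℝ => F q.2 q.1) (univ ×ˢ J)
  immersion : ∀ t ∈ J, ∀ p : M,
    Function.Injective (mfderiv I 𝓘(ℝ, EuclideanSpace ℝ (Fin (n + 1))) (F t) p)
  smooth_normal : ContMDiffOn (I.prod 𝓘(ℝ, ℝ)) 𝓘(ℝ, EuclideanSpace ℝ (Fin (n + 1))) ∞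
    (fun q : M × ℝ => ν q.2 q.1) (univ ×ˢ J)
  norm_normal : ∀ t ∈ J, ∀ p : M, ‖ν t p‖ = 1
  normal : ∀ t ∈ J, ∀ p : M, ∀ v : TangentSpace I p,
    inner ℝ (ν t p)
      (mfderiv I 𝓘(ℝ, EuclideanSpace ℝ (Fin (n + 1))) (F t) p v :
        EuclideanSpace ℝ (Fin (n + 1))) = 0
  flow : ∀ t ∈ J, ∀ p : M,
    HasDerivWithinAt (fun τ => F τ p) (-(meanCurvature I (F t) (ν t) p • ν t p)) J t

/-- The rotational Killing field `Kᵢ(x) = xₙ₊₁ eᵢ - xᵢ eₙ₊₁` of `ℝⁿ⁺¹`, for `i = 1, …, n`. -/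
def killing (i : Fin n) (x : EuclideanSpace ℝ (Fin (n + 1))) : EuclideanSpace ℝ (Fin (n + 1)) :=
  x (Fin.last n) • EuclideanSpace.single i.castSucc (1 : ℝ)
    - x i.castSucc • EuclideanSpace.single (Fin.last n) (1 : ℝ)

/-- The quantity `sᵢ = ⟨ν, Kᵢ⟩` along a hypersurface `f` with unit normal `ν`. -/
def killingSupport (i : Fin n) (f ν : M → EuclideanSpace ℝ (Fin (n + 1))) (p : M) : ℝ :=
  ⟪ν p, killing i (f p)⟫_ℝ

end MCF

end

/-! Each `killing i` is a skew-symmetric linear field K, so s = ⟨ν, KF⟩, and only skewness of K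
matters.

In space, Δ⟨N, KX⟩ = -|A|²⟨N, KX⟩ + ⟨∇H, KX⟩ (`laplace_support`, whose algebraic core is
`contracted_hessian_support`). The Hessian has three kinds of terms. Second derivatives of N give
-|A|²N + ∇H by the Codazzi equation. Terms pairing ∂N with K∂X contract the symmetric tensor g⁻¹hg⁻¹
with a skew one and vanish. The covariant second derivatives of X are normal, hence are killed by
⟨N, KN⟩ = 0.

In time, ∂ₜν = ∇H (`hasDerivWithinAt_normal`), obtained by differentiating |ν|² = 1 and ⟨ν, ∂ᵢF⟩ = 0
along the flow. The velocity contributes ⟨ν, K(-Hν)⟩ = 0, so ∂ₜs = ⟨∇H, KF⟩, and subtracting the two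
formulas leaves |A|²s.

Differentiating H requires one fixed chart, whereas `meanCurvature` at each point uses that point's
own chart; `meanCurvature_eq_patchMeanCurvature` reconciles the two. All derivatives are taken
within `range I` and `J`, which covers boundary points and endpoints. -/

noncomputable section

namespace MCF

/-! ### Pointwise linear algebra in the moving frame (X₁, …, Xₙ, N). -/

section Frame

variable {n : ℕ} {V : Type*} [NormedAddCommGroup V] [InnerProductSpace ℝ V]

/-- Expansion of a vector in the moving frame given by a basis `X` of a hyperplane and its
unit normal `N`. -/
lemma eq_frame_expansion (hV : Module.finrank ℝ V = n + 1) {X : Fin n → V} {N : V}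
    (hX : LinearIndependent ℝ X) (hN : ⟪N, N⟫_ℝ = 1) (hNX : ∀ i, ⟪N, X i⟫_ℝ = 0) (v : V) :
    v = ⟪v, N⟫_ℝ • N + ∑ k, (∑ l, (gram ℝ X)⁻¹ k l * ⟪v, X l⟫_ℝ) • X k := by
  have hfin : FiniteDimensional ℝ V := Module.finite_of_finrank_eq_succ hV
  have hdet : IsUnit (gram ℝ X).det :=
    isUnit_iff_ne_zero.mpr (det_gram_ne_zero_iff_linearIndependent.mpr hX)
  have hNspan : N ∉ Submodule.span ℝ (range X) := by
    intro h
    have h2 : ∀ w ∈ Submodule.span ℝ (range X), ⟪N, w⟫_ℝ = 0 := by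
      intro w hw
      induction hw using Submodule.span_induction with
      | mem x hx => obtain ⟨i, rfl⟩ := hx; exact hNX i
      | zero => simp
      | add x y _ _ hx hy => rw [inner_add_right, hx, hy, add_zero]
      | smul a x _ hx => rw [inner_smul_right, hx, mul_zero]
    have := h2 N h
    rw [hN] at this
    exact one_ne_zero this
  have hli : LinearIndependent ℝ (Fin.cons N X : Fin (n + 1) → V) :=
    linearIndependent_finCons.mpr ⟨hX, hNspan⟩
  have htop := hli.span_eq_top_of_card_eq_finrank' (by simp [hV])
  -- The defect `u` of the expansion is orthogonal to every frame vector, and the n + 1 independent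
  -- frame vectors span V, so `u` vanishes.
  set u := v - (⟪v, N⟫_ℝ • N + ∑ k, (∑ l, (gram ℝ X)⁻¹ k l * ⟪v, X l⟫_ℝ) • X k) with hu
  have huN : ⟪u, N⟫_ℝ = 0 := by
    rw [hu, inner_sub_left, inner_add_left, sum_inner, inner_smul_left, hN]
    have : ∀ k, ⟪X k, N⟫_ℝ = 0 := fun k => by rw [real_inner_comm]; exact hNX k
    simp [inner_smul_left, this]
  have huX : ∀ m, ⟪u, X m⟫_ℝ = 0 := by
    intro m
    rw [hu, inner_sub_left, inner_add_left, sum_inner, inner_smul_left, hNX]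
    simp only [inner_smul_left, mul_zero, zero_add, conj_trivial]
    have h1 : ∑ k, (∑ l, (gram ℝ X)⁻¹ k l * ⟪v, X l⟫_ℝ) * ⟪X k, X m⟫_ℝ
        = ((gram ℝ X) *ᵥ ((gram ℝ X)⁻¹ *ᵥ fun l => ⟪v, X l⟫_ℝ)) m := by
      simp only [mulVec, dotProduct, gram_apply]
      refine Finset.sum_congr rfl fun k _ => ?_
      rw [mul_comm, real_inner_comm]
    rw [h1, mulVec_mulVec, mul_nonsing_inv _ hdet, one_mulVec, sub_self]
  have hu0 : ∀ w ∈ Submodule.span ℝ (range (Fin.cons N X : Fin (n + 1) → V)), ⟪u, w⟫_ℝ = 0 := by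
    intro w hw
    induction hw using Submodule.span_induction with
    | mem x hx =>
      obtain ⟨i, rfl⟩ := hx
      refine Fin.cases ?_ (fun j => ?_) i
      · simpa using huN
      · simpa using huX j
    | zero => simp
    | add x y _ _ hx hy => rw [inner_add_right, hx, hy, add_zero]
    | smul a x _ hx => rw [inner_smul_right, hx, mul_zero]
  have : u = 0 := inner_self_eq_zero.mp (hu0 u (by rw [htop]; trivial))
  exact sub_eq_zero.mp this

/-- Parseval's identity in the moving frame. -/
lemma inner_eq_frame_sum (hV : Module.finrank ℝ V = n + 1) {X : Fin n → V} {N : V}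
    (hX : LinearIndependent ℝ X) (hN : ⟪N, N⟫_ℝ = 1) (hNX : ∀ i, ⟪N, X i⟫_ℝ = 0) (v w : V) :
    ⟪v, w⟫_ℝ = ⟪v, N⟫_ℝ * ⟪w, N⟫_ℝ
      + ∑ k, ∑ l, (gram ℝ X)⁻¹ k l * ⟪v, X l⟫_ℝ * ⟪w, X k⟫_ℝ := by
  conv_lhs => rw [eq_frame_expansion hV hX hN hNX v]
  rw [inner_add_left, sum_inner, inner_smul_left, real_inner_comm w N, conj_trivial]
  simp only [inner_smul_left, conj_trivial, Finset.sum_mul]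
  congr 1
  refine Finset.sum_congr rfl fun k _ => Finset.sum_congr rfl fun l _ => ?_
  rw [real_inner_comm, real_inner_comm w (X k)]

lemma inv_gram_symm (X : Fin n → V) (i j : Fin n) : (gram ℝ X)⁻¹ i j = (gram ℝ X)⁻¹ j i := by
  have h : (gram ℝ X)ᵀ = gram ℝ X := by
    ext a b
    simp [gram_apply, real_inner_comm]
  conv_lhs => rw [← h, ← transpose_nonsing_inv]
  rfl

/-- The contraction of a symmetric with a skew-symmetric array vanishes. -/
lemma sum_symm_mul_skew_eq_zero {B A : Fin n → Fin n → ℝ} (hB : ∀ i j, B i j = B j i)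
    (hA : ∀ i j, A i j = -A j i) : ∑ i, ∑ j, B i j * A i j = 0 := by
  have h : ∑ i, ∑ j, B i j * A i j = -∑ i, ∑ j, B i j * A i j := by
    conv_lhs => rw [Finset.sum_comm]
    simp only [← Finset.sum_neg_distrib]
    refine Finset.sum_congr rfl fun i _ => Finset.sum_congr rfl fun j _ => ?_
    rw [hB, hA]; ring
  linarith

/-- The pointwise identity `Δ⟨N, KX⟩ = -|A|² ⟨N, KX⟩ + ⟨∇H, KX⟩` for a skew-symmetric `K`, expressed
through the first and second partial derivatives `X i`, `X2 i j`, `N1 i`, `N2 i j` of the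
immersion and its normal; `Y` is the value `KX`. -/
lemma contracted_hessian_support (hV : Module.finrank ℝ V = n + 1) {X : Fin n → V} {N : V}
    (hX : LinearIndependent ℝ X) (hN : ⟪N, N⟫_ℝ = 1) (hNX : ∀ i, ⟪N, X i⟫_ℝ = 0)
    {X2 N2 : Fin n → Fin n → V} {N1 : Fin n → V}
    (hX2 : ∀ i j, X2 i j = X2 j i)
    (hN1 : ∀ i, ⟪N1 i, N⟫_ℝ = 0) (hNN2 : ∀ i j, ⟪N2 i j, N⟫_ℝ = -⟪N1 i, N1 j⟫_ℝ)
    (hh : ∀ i j, ⟪N1 i, X j⟫_ℝ = -⟪X2 i j, N⟫_ℝ)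
    (hcod : ∀ i j m, ⟪N2 i j, X m⟫_ℝ + ⟪N1 j, X2 i m⟫_ℝ = ⟪N2 i m, X j⟫_ℝ + ⟪N1 m, X2 i j⟫_ℝ)
    {Γ : Fin n → Fin n → Fin n → ℝ}
    (hΓ : ∀ k i j, Γ k i j = ∑ l, (gram ℝ X)⁻¹ k l * ⟪X2 i j, X l⟫_ℝ)
    {K : V →L[ℝ] V} (hK : ∀ v w, ⟪v, K w⟫_ℝ = -⟪w, K v⟫_ℝ) (Y : V) :
    ∑ i, ∑ j, (gram ℝ X)⁻¹ i j *
      ((⟪N2 i j, Y⟫_ℝ + ⟪N1 j, K (X i)⟫_ℝ + ⟪N1 i, K (X j)⟫_ℝ + ⟪N, K (X2 i j)⟫_ℝ)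
        - ∑ k, Γ k i j * (⟪N1 k, Y⟫_ℝ + ⟪N, K (X k)⟫_ℝ))
    = -(∑ i, ∑ j, ∑ k, ∑ l, (gram ℝ X)⁻¹ i k * (gram ℝ X)⁻¹ j l
          * ⟪N1 i, X j⟫_ℝ * ⟪N1 k, X l⟫_ℝ) * ⟪N, Y⟫_ℝ
      + ∑ a, ∑ b, (gram ℝ X)⁻¹ a b *
          (∑ i, ∑ j, (gram ℝ X)⁻¹ i j * (⟪N2 i b, X j⟫_ℝ - ⟪N1 j, X2 i b⟫_ℝ)) * ⟪Y, X a⟫_ℝ := by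
  set G := (gram ℝ X)⁻¹ with hG
  have hGs : ∀ i j, G i j = G j i := inv_gram_symm X
  have hhs : ∀ i j, ⟪N1 i, X j⟫_ℝ = ⟪N1 j, X i⟫_ℝ := fun i j => by rw [hh, hh, hX2]
  have hframe := inner_eq_frame_sum hV hX hN hNX
  have hKs : ∀ v, ⟪v, K v⟫_ℝ = 0 := fun v => by linarith [hK v v]
  -- Gauss formula
  have hgauss : ∀ i j, ⟪N, K (X2 i j)⟫_ℝ - ∑ k, Γ k i j * ⟪N, K (X k)⟫_ℝ = 0 := by
    intro i j
    have h := eq_frame_expansion hV hX hN hNX (X2 i j)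
    simp only [← hG, ← hΓ] at h
    -- The tangential coefficients of `X2 i j` are the Γ, and its normal part contributes a multiple
    -- of ⟨N, KN⟩ = 0.
    have h2 := congrArg (fun v => ⟪N, K v⟫_ℝ) h
    simp only [map_add, map_smul, map_sum, inner_add_right, inner_sum, inner_smul_right, hKs] at h2
    rw [h2]; ring
  -- tangential contraction of the third-order terms
  have hΓN : ∀ i j a, ∑ k, Γ k i j * ⟪N1 k, X a⟫_ℝ = ⟪N1 a, X2 i j⟫_ℝ := by
    intro i j a
    rw [real_inner_comm, hframe, hN1, mul_zero, zero_add]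
    refine Finset.sum_congr rfl fun k _ => ?_
    rw [hΓ, Finset.sum_mul]
    refine Finset.sum_congr rfl fun l _ => ?_
    rw [hhs]
  have hNY : ∀ i j, ⟪N2 i j, Y⟫_ℝ - ∑ k, Γ k i j * ⟪N1 k, Y⟫_ℝ
      = -⟪N1 i, N1 j⟫_ℝ * ⟪N, Y⟫_ℝ
        + ∑ a, ∑ b, G a b * (⟪N2 i b, X j⟫_ℝ - ⟪N1 j, X2 i b⟫_ℝ) * ⟪Y, X a⟫_ℝ := by
    intro i j
    have h1 : ⟪N2 i j, Y⟫_ℝ - ∑ k, Γ k i j * ⟪N1 k, Y⟫_ℝ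
        = ⟪N2 i j - ∑ k, Γ k i j • N1 k, Y⟫_ℝ := by
      rw [inner_sub_left, sum_inner]; simp only [inner_smul_left, conj_trivial]
    have h2 : ⟪N2 i j - ∑ k, Γ k i j • N1 k, N⟫_ℝ = -⟪N1 i, N1 j⟫_ℝ := by
      rw [inner_sub_left, sum_inner]; simp [inner_smul_left, hN1, hNN2]
    -- Codazzi exchanges j and b; contracted with G in i and j, the right side is ∂_b H as computed
    -- in `partialDeriv_patchMeanCurvature`.
    have h3 : ∀ b, ⟪N2 i j - ∑ k, Γ k i j • N1 k, X b⟫_ℝ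
        = ⟪N2 i b, X j⟫_ℝ - ⟪N1 j, X2 i b⟫_ℝ := by
      intro b
      rw [inner_sub_left, sum_inner]; simp only [inner_smul_left, conj_trivial]
      rw [hΓN]
      linarith [hcod i j b]
    rw [h1, hframe, h2, real_inner_comm N Y]
    simp only [h3, ← hG]
  -- the mixed terms
  have hmix : ∑ i, ∑ j, G i j * ⟪N1 j, K (X i)⟫_ℝ = 0 := by
    have h1 : ∀ i j, ⟪N1 j, K (X i)⟫_ℝ = ∑ k, ∑ l, G k l * ⟪N1 j, X l⟫_ℝ * ⟪K (X i), X k⟫_ℝ := by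
      intro i j
      rw [hframe, hN1, zero_mul, zero_add]
    -- Expanding the tangential vector `N1 j` in the frame exhibits the contraction of the symmetric
    -- g⁻¹hg⁻¹ with the skew ⟨X k, K(X i)⟩.
    have h2 : ∑ i, ∑ j, G i j * ⟪N1 j, K (X i)⟫_ℝ
        = ∑ i, ∑ k, (∑ j, ∑ l, G i j * G k l * ⟪N1 j, X l⟫_ℝ) * ⟪X k, K (X i)⟫_ℝ := by
      refine Finset.sum_congr rfl fun i _ => ?_
      simp only [h1, Finset.mul_sum, Finset.sum_mul]
      rw [Finset.sum_comm]
      refine Finset.sum_congr rfl fun k _ => Finset.sum_congr rfl fun j _ =>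
        Finset.sum_congr rfl fun l _ => ?_
      rw [real_inner_comm (X k)]; ring
    rw [h2]
    refine sum_symm_mul_skew_eq_zero (fun i k => ?_) (fun i k => hK _ _)
    rw [Finset.sum_comm]
    refine Finset.sum_congr rfl fun j _ => Finset.sum_congr rfl fun l _ => ?_
    rw [hhs]; ring
  have hmix' : ∑ i, ∑ j, G i j * ⟪N1 i, K (X j)⟫_ℝ = 0 := by
    rw [← hmix, Finset.sum_comm]
    refine Finset.sum_congr rfl fun j _ => Finset.sum_congr rfl fun l _ => ?_
    rw [hGs]
  -- |A|² is the trace of the third fundamental form ⟨∂ᵢN, ∂ⱼN⟩, by Parseval for the tangential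
  -- vectors `N1 i`.
  have hA : ∑ i, ∑ j, ∑ k, ∑ l, G i k * G j l * ⟪N1 i, X j⟫_ℝ * ⟪N1 k, X l⟫_ℝ
      = ∑ i, ∑ j, G i j * ⟪N1 i, N1 j⟫_ℝ := by
    refine Finset.sum_congr rfl fun i _ => ?_
    rw [Finset.sum_comm]
    refine Finset.sum_congr rfl fun k _ => ?_
    rw [hframe (N1 i), hN1, zero_mul, zero_add, Finset.sum_comm]
    simp only [Finset.mul_sum]
    refine Finset.sum_congr rfl fun l _ => Finset.sum_congr rfl fun j _ => ?_
    rw [hGs j l]; ring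
  have hterm : ∀ i j, G i j *
      ((⟪N2 i j, Y⟫_ℝ + ⟪N1 j, K (X i)⟫_ℝ + ⟪N1 i, K (X j)⟫_ℝ + ⟪N, K (X2 i j)⟫_ℝ)
        - ∑ k, Γ k i j * (⟪N1 k, Y⟫_ℝ + ⟪N, K (X k)⟫_ℝ))
      = G i j * ⟪N1 i, N1 j⟫_ℝ * (-⟪N, Y⟫_ℝ)
        + G i j * ∑ a, ∑ b, G a b * (⟪N2 i b, X j⟫_ℝ - ⟪N1 j, X2 i b⟫_ℝ) * ⟪Y, X a⟫_ℝ
        + G i j * ⟪N1 j, K (X i)⟫_ℝ + G i j * ⟪N1 i, K (X j)⟫_ℝ := by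
    intro i j
    simp only [mul_add (Γ _ i j), Finset.sum_add_distrib]
    linear_combination G i j * hNY i j + G i j * hgauss i j
  simp only [hterm, Finset.sum_add_distrib]
  rw [hmix, hmix', hA, add_zero, add_zero]
  simp only [← Finset.sum_mul]
  rw [mul_neg, neg_mul]
  congr 1
  simp only [Finset.mul_sum, Finset.sum_mul]
  have hcomm : ∀ f : Fin n → Fin n → Fin n → Fin n → ℝ,
      ∑ i, ∑ j, ∑ a, ∑ b, f i j a b = ∑ a, ∑ b, ∑ i, ∑ j, f i j a b := by
    intro f
    calc _ = ∑ i, ∑ a, ∑ b, ∑ j, f i j a b := Finset.sum_congr rfl fun i _ => by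
          rw [Finset.sum_comm]
          exact Finset.sum_congr rfl fun a _ => Finset.sum_comm
      _ = _ := by
          rw [Finset.sum_comm]
          exact Finset.sum_congr rfl fun a _ => Finset.sum_comm
  rw [hcomm]
  refine Finset.sum_congr rfl fun a _ => Finset.sum_congr rfl fun b _ =>
    Finset.sum_congr rfl fun i _ => Finset.sum_congr rfl fun j _ => ?_
  ring

/-- If W is the variation of the frame X, then δg⁻¹ = -g⁻¹(δg)g⁻¹; this evaluates -(δg⁻¹)ⁱʲhᵢⱼ, a
term in the derivative of H. The two halves of δg contribute equally because g⁻¹ and h are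
symmetric, and each collapses by Parseval. -/
lemma contracted_inv_gram_variation (hV : Module.finrank ℝ V = n + 1) {X : Fin n → V} {N : V}
    (hX : LinearIndependent ℝ X) (hN : ⟪N, N⟫_ℝ = 1) (hNX : ∀ i, ⟪N, X i⟫_ℝ = 0)
    {N1 : Fin n → V} (hN1 : ∀ i, ⟪N1 i, N⟫_ℝ = 0) (hh : ∀ i j, ⟪N1 i, X j⟫_ℝ = ⟪N1 j, X i⟫_ℝ)
    (W : Fin n → V) :
    ∑ i, ∑ j, (∑ a, ∑ b, (gram ℝ X)⁻¹ i a * (⟪W a, X b⟫_ℝ + ⟪X a, W b⟫_ℝ) * (gram ℝ X)⁻¹ b j)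
        * ⟪N1 i, X j⟫_ℝ
      = 2 * ∑ i, ∑ j, (gram ℝ X)⁻¹ i j * ⟪N1 j, W i⟫_ℝ := by
  set G := (gram ℝ X)⁻¹ with hG
  have hGs : ∀ i j, G i j = G j i := inv_gram_symm X
  have h1 : ∑ i, ∑ j, (∑ a, ∑ b, G i a * ⟪W a, X b⟫_ℝ * G b j) * ⟪N1 i, X j⟫_ℝ
      = ∑ i, ∑ j, G i j * ⟪N1 j, W i⟫_ℝ := by
    rw [Finset.sum_comm (f := fun i j => G i j * ⟪N1 j, W i⟫_ℝ)]
    refine Finset.sum_congr rfl fun i _ => ?_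
    simp only [Finset.sum_mul]
    rw [Finset.sum_comm]
    refine Finset.sum_congr rfl fun a _ => ?_
    rw [inner_eq_frame_sum hV hX hN hNX (N1 i), hN1, zero_mul, zero_add, Finset.sum_comm]
    simp only [Finset.mul_sum]
    refine Finset.sum_congr rfl fun b _ => Finset.sum_congr rfl fun j _ => ?_
    rw [← hG, hGs i a]; ring
  have h2 : ∑ i, ∑ j, (∑ a, ∑ b, G i a * ⟪X a, W b⟫_ℝ * G b j) * ⟪N1 i, X j⟫_ℝ
      = ∑ i, ∑ j, (∑ a, ∑ b, G i a * ⟪W a, X b⟫_ℝ * G b j) * ⟪N1 i, X j⟫_ℝ := by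
    rw [Finset.sum_comm]
    refine Finset.sum_congr rfl fun i _ => Finset.sum_congr rfl fun j _ => ?_
    rw [hh j i, Finset.sum_comm]
    congr 1
    refine Finset.sum_congr rfl fun a _ => Finset.sum_congr rfl fun b _ => ?_
    rw [hGs a i, hGs b j, real_inner_comm]; ring
  rw [two_mul]
  conv_rhs => rw [← h1]
  conv_rhs => arg 2; rw [← h2]
  simp only [mul_add, add_mul, Finset.sum_add_distrib]

end Frame

/-! ### Calculus of partial derivatives within the range of the model. -/

section Calculus

open Filter Topology

variable {n : ℕ} {H : Type*} [TopologicalSpace H]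
  {I : ModelWithCorners ℝ (EuclideanSpace ℝ (Fin n)) H}
  {x : EuclideanSpace ℝ (Fin n)}

section

variable {V W : Type*} [NormedAddCommGroup V] [NormedSpace ℝ V]
  [NormedAddCommGroup W] [NormedSpace ℝ W] {f g : EuclideanSpace ℝ (Fin n) → V}

lemma partialDeriv_congr (hx : x ∈ range I) (h : f =ᶠ[𝓝[range I] x] g) (i : Fin n) :
    partialDeriv I i f x = partialDeriv I i g x := by
  rw [partialDeriv, partialDeriv, h.fderivWithin_eq (h.self_of_nhdsWithin hx)]

lemma partialDeriv_eventuallyEq (h : f =ᶠ[𝓝[range I] x] g) (i : Fin n) :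
    partialDeriv I i f =ᶠ[𝓝[range I] x] partialDeriv I i g := by
  filter_upwards [eventually_eventually_nhdsWithin.mpr h, self_mem_nhdsWithin] with y hy hyI
  exact partialDeriv_congr hyI hy i

@[simp] lemma partialDeriv_const (c : V) (i : Fin n) :
    partialDeriv I i (fun _ => c) x = 0 := by
  simp [partialDeriv]

lemma partialDeriv_add (hx : x ∈ range I) (hf : DifferentiableWithinAt ℝ f (range I) x)
    (hg : DifferentiableWithinAt ℝ g (range I) x) (i : Fin n) :
    partialDeriv I i (fun y => f y + g y) x = partialDeriv I i f x + partialDeriv I i g x := by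
  simp only [partialDeriv, fderivWithin_fun_add (I.uniqueDiffOn x hx) hf hg]
  rfl

lemma partialDeriv_sum (hx : x ∈ range I) {ι : Type*} {s : Finset ι}
    {f : ι → EuclideanSpace ℝ (Fin n) → V}
    (hf : ∀ a ∈ s, DifferentiableWithinAt ℝ (f a) (range I) x) (i : Fin n) :
    partialDeriv I i (fun y => ∑ a ∈ s, f a y) x = ∑ a ∈ s, partialDeriv I i (f a) x := by
  simp only [partialDeriv, fderivWithin_fun_sum (I.uniqueDiffOn x hx) hf]
  simp

lemma partialDeriv_clm_comp (hx : x ∈ range I) (hf : DifferentiableWithinAt ℝ f (range I) x)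
    (K : V →L[ℝ] W) (i : Fin n) :
    partialDeriv I i (fun y => K (f y)) x = K (partialDeriv I i f x) := by
  have := (K.hasFDerivAt.comp_hasFDerivWithinAt x hf.hasFDerivWithinAt).fderivWithin
    (I.uniqueDiffOn x hx)
  simp only [partialDeriv]
  exact congrArg (fun L => L (EuclideanSpace.single i (1 : ℝ))) this

lemma partialDeriv_smul (hx : x ∈ range I) {c : EuclideanSpace ℝ (Fin n) → ℝ}
    (hc : DifferentiableWithinAt ℝ c (range I) x) (hf : DifferentiableWithinAt ℝ f (range I) x)
    (i : Fin n) :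
    partialDeriv I i (fun y => c y • f y) x
      = c x • partialDeriv I i f x + partialDeriv I i c x • f x := by
  simp only [partialDeriv, fderivWithin_fun_smul (I.uniqueDiffOn x hx) hc hf]
  rfl

lemma partialDeriv_mul (hx : x ∈ range I) {c d : EuclideanSpace ℝ (Fin n) → ℝ}
    (hc : DifferentiableWithinAt ℝ c (range I) x) (hd : DifferentiableWithinAt ℝ d (range I) x)
    (i : Fin n) :
    partialDeriv I i (fun y => c y * d y) x
      = c x * partialDeriv I i d x + partialDeriv I i c x * d x :=
  partialDeriv_smul hx hc hd i

lemma contDiffWithinAt_partialDeriv (hx : x ∈ range I) (hf : ContDiffWithinAt ℝ ∞ f (range I) x)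
    (i : Fin n) : ContDiffWithinAt ℝ ∞ (partialDeriv I i f) (range I) x :=
  (hf.fderivWithin_right I.uniqueDiffOn (m := ∞) (by simp) hx).clm_apply contDiffWithinAt_const

/-- Symmetry survives at boundary points because `range I` has unique derivatives and lies in the
closure of its interior. -/
lemma partialDeriv_comm (hx : x ∈ range I) (hf : ContDiffWithinAt ℝ ∞ f (range I) x)
    (i j : Fin n) :
    partialDeriv I i (partialDeriv I j f) x = partialDeriv I j (partialDeriv I i f) x := by
  have hd : DifferentiableWithinAt ℝ (fderivWithin ℝ f (range I)) (range I) x :=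
    (hf.fderivWithin_right I.uniqueDiffOn (m := ∞) (by simp) hx).differentiableWithinAt (by simp)
  have key : ∀ i j : Fin n, partialDeriv I i (partialDeriv I j f) x
      = fderivWithin ℝ (fderivWithin ℝ f (range I)) (range I) x (EuclideanSpace.single i 1)
          (EuclideanSpace.single j 1) := fun i j =>
    partialDeriv_clm_comp hx hd
      (ContinuousLinearMap.apply ℝ V (EuclideanSpace.single j (1 : ℝ))) i
  rw [key, key]
  exact hf.isSymmSndFDerivWithinAt (by simpa using WithTop.coe_le_coe.mpr (le_top : (2 : ℕ∞) ≤ ⊤)) I.uniqueDiffOn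
    (I.range_subset_closure_interior hx) hx _ _

end

section

variable {V : Type*} [NormedAddCommGroup V] [InnerProductSpace ℝ V]
  {f g : EuclideanSpace ℝ (Fin n) → V}

lemma partialDeriv_inner (hx : x ∈ range I) (hf : DifferentiableWithinAt ℝ f (range I) x)
    (hg : DifferentiableWithinAt ℝ g (range I) x) (i : Fin n) :
    partialDeriv I i (fun y => ⟪f y, g y⟫_ℝ) x
      = ⟪partialDeriv I i f x, g x⟫_ℝ + ⟪f x, partialDeriv I i g x⟫_ℝ := by
  have h := (hf.hasFDerivWithinAt.inner ℝ hg.hasFDerivWithinAt).fderivWithin (I.uniqueDiffOn x hx)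
  simp only [partialDeriv, h]
  simp [add_comm]

end

section MatrixInverse

variable {g : EuclideanSpace ℝ (Fin n) → Matrix (Fin n) (Fin n) ℝ}

lemma differentiableWithinAt_det {E ι : Type*} [Fintype ι] [DecidableEq ι] [NormedAddCommGroup E]
    [NormedSpace ℝ E] {s : Set E} {y : E} {g : E → Matrix ι ι ℝ}
    (hg : ∀ i j, DifferentiableWithinAt ℝ (fun z => g z i j) s y) :
    DifferentiableWithinAt ℝ (fun z => (g z).det) s y := by
  simp only [det_apply']
  exact DifferentiableWithinAt.fun_sum fun σ _ =>
    (differentiableWithinAt_const _).mul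
      (HasFDerivWithinAt.finsetProd (g := fun i z => g z (σ i) i)
        fun i _ => (hg (σ i) i).hasFDerivWithinAt).differentiableWithinAt

/-- By Cramer's rule the entries are quotients of determinants; in the numerator one row is replaced
by a constant unit vector. -/
lemma differentiableWithinAt_inv_matrix {E ι : Type*} [Fintype ι] [DecidableEq ι]
    [NormedAddCommGroup E]
    [NormedSpace ℝ E] {s : Set E} {y : E} {g : E → Matrix ι ι ℝ}
    (hg : ∀ i j, DifferentiableWithinAt ℝ (fun z => g z i j) s y) (hdet : (g y).det ≠ 0)
    (i j : ι) : DifferentiableWithinAt ℝ (fun z => (g z)⁻¹ i j) s y := by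
  simp only [inv_def, Ring.inverse_eq_inv', Matrix.smul_apply, smul_eq_mul, adjugate_apply]
  refine ((differentiableWithinAt_det hg).inv hdet).mul (differentiableWithinAt_det fun a b => ?_)
  by_cases h : a = j
  · subst h
    simpa using differentiableWithinAt_const _
  · simpa [updateRow_ne h] using hg a b

/-- Differentiate g g⁻¹ = 1, which holds near x because det g stays nonzero there. -/
lemma partialDeriv_inv_matrix (hx : x ∈ range I)
    (hg : ∀ i j, DifferentiableWithinAt ℝ (fun z => g z i j) (range I) x)
    (hdet : (g x).det ≠ 0) (m i j : Fin n) :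
    partialDeriv I m (fun z => (g z)⁻¹ i j) x
      = -∑ a, ∑ b, (g x)⁻¹ i a * partialDeriv I m (fun z => g z a b) x * (g x)⁻¹ b j := by
  have hinv := differentiableWithinAt_inv_matrix hg hdet
  set D : Matrix (Fin n) (Fin n) ℝ := Matrix.of fun a b => partialDeriv I m (fun z => g z a b) x
  set D' : Matrix (Fin n) (Fin n) ℝ :=
    Matrix.of fun a b => partialDeriv I m (fun z => (g z)⁻¹ a b) x
  have hne : ∀ᶠ z in 𝓝[range I] x, (g z).det ≠ 0 :=
    (differentiableWithinAt_det hg).continuousWithinAt.eventually_ne hdet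
  have h0 : g x * D' + D * (g x)⁻¹ = 0 := by
    ext a c
    have h1 : (fun z => ∑ b, g z a b * (g z)⁻¹ b c) =ᶠ[𝓝[range I] x]
        fun _ => (1 : Matrix (Fin n) (Fin n) ℝ) a c := by
      filter_upwards [hne] with z hz
      rw [← mul_nonsing_inv (g z) (isUnit_iff_ne_zero.mpr hz), mul_apply]
    have h2 := partialDeriv_congr hx h1 m
    rw [partialDeriv_const, partialDeriv_sum (f := fun b z => g z a b * (g z)⁻¹ b c) hx
      fun b _ => (hg a b).mul (hinv b c)] at h2
    simp only [partialDeriv_mul hx (hg a _) (hinv _ c), Finset.sum_add_distrib] at h2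
    simpa [mul_apply, D, D'] using h2
  have h3 : D' = -((g x)⁻¹ * D * (g x)⁻¹) := by
    have h4 : (g x)⁻¹ * (g x * D' + D * (g x)⁻¹) = 0 := by rw [h0, mul_zero]
    rw [mul_add, ← mul_assoc, nonsing_inv_mul _ (isUnit_iff_ne_zero.mpr hdet), one_mul,
      ← mul_assoc] at h4
    exact eq_neg_of_add_eq_zero_left h4
  have h5 := congrFun (congrFun h3 i) j
  simp only [D', of_apply, Matrix.neg_apply, mul_apply, Finset.sum_mul] at h5
  rw [h5, Finset.sum_comm]
  rfl

end MatrixInverse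

end Calculus

/-! ### Local hypersurface geometry in a fixed chart. -/

section Patch

open Filter Topology

variable {n : ℕ} {H : Type*} [TopologicalSpace H]
  {I : ModelWithCorners ℝ (EuclideanSpace ℝ (Fin n)) H}

/-- Near `x`, the map `X` is a smooth local parametrisation of a hypersurface, regular at `x`,
with smooth unit normal `N`. -/
structure IsNormalPatchAt (I : ModelWithCorners ℝ (EuclideanSpace ℝ (Fin n)) H)
    (X N : EuclideanSpace ℝ (Fin n) → EuclideanSpace ℝ (Fin (n + 1)))
    (x : EuclideanSpace ℝ (Fin n)) : Prop where
  mem_range : x ∈ range I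
  smooth : ∀ᶠ y in 𝓝[range I] x, ContDiffWithinAt ℝ ∞ X (range I) y
  smooth_normal : ∀ᶠ y in 𝓝[range I] x, ContDiffWithinAt ℝ ∞ N (range I) y
  inner_self : ∀ᶠ y in 𝓝[range I] x, ⟪N y, N y⟫_ℝ = 1
  normal : ∀ᶠ y in 𝓝[range I] x, ∀ i, ⟪N y, partialDeriv I i X y⟫_ℝ = 0
  linearIndependent : LinearIndependent ℝ fun i => partialDeriv I i X x

/-- Mean curvature `∑ gⁱʲ hᵢⱼ` of a local parametrisation. -/
def patchMeanCurvature (I : ModelWithCorners ℝ (EuclideanSpace ℝ (Fin n)) H)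
    (X N : EuclideanSpace ℝ (Fin n) → EuclideanSpace ℝ (Fin (n + 1)))
    (x : EuclideanSpace ℝ (Fin n)) : ℝ :=
  ∑ i, ∑ j, (metric I X x)⁻¹ i j * secondFundamentalForm I X N x i j

lemma metric_eq_gram (X : EuclideanSpace ℝ (Fin n) → EuclideanSpace ℝ (Fin (n + 1)))
    (x : EuclideanSpace ℝ (Fin n)) : metric I X x = gram ℝ fun i => partialDeriv I i X x := rfl

lemma _root_.ContDiffWithinAt.differentiable_partialDeriv {V : Type*} [NormedAddCommGroup V]
    [NormedSpace ℝ V] {f : EuclideanSpace ℝ (Fin n) → V} {x : EuclideanSpace ℝ (Fin n)}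
    (hf : ContDiffWithinAt ℝ ∞ f (range I) x) (hx : x ∈ range I) (i : Fin n) :
    DifferentiableWithinAt ℝ (partialDeriv I i f) (range I) x :=
  (contDiffWithinAt_partialDeriv hx hf i).differentiableWithinAt (by simp)

namespace IsNormalPatchAt

variable {X N : EuclideanSpace ℝ (Fin n) → EuclideanSpace ℝ (Fin (n + 1))}
  {x : EuclideanSpace ℝ (Fin n)}

section

variable (h : IsNormalPatchAt I X N x)
include h

lemma smoothAt : ContDiffWithinAt ℝ ∞ X (range I) x := h.smooth.self_of_nhdsWithin h.mem_range

lemma smoothAt_normal : ContDiffWithinAt ℝ ∞ N (range I) x :=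
  h.smooth_normal.self_of_nhdsWithin h.mem_range

/-- Derivative of |N|² = 1, kept on a neighbourhood so that it can be differentiated again. -/
lemma eventually_inner_partialDeriv_normal :
    ∀ᶠ y in 𝓝[range I] x, ∀ i, ⟪partialDeriv I i N y, N y⟫_ℝ = 0 := by
  rw [eventually_all]
  intro i
  filter_upwards [partialDeriv_eventuallyEq h.inner_self i, h.smooth_normal,
    self_mem_nhdsWithin] with y h1 h2 hy
  have hd := h2.differentiableWithinAt (by simp)
  rw [partialDeriv_inner hy hd hd, partialDeriv_const, real_inner_comm (N y)] at h1
  linarith [real_inner_comm (N y) (partialDeriv I i N y)]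

/-- Derivative of ⟨N, ∂ⱼX⟩ = 0; symmetry of h then follows from that of ∂ᵢ∂ⱼX. -/
lemma eventually_secondFundamentalForm_eq :
    ∀ᶠ y in 𝓝[range I] x, ∀ i j, ⟪partialDeriv I i N y, partialDeriv I j X y⟫_ℝ
      = -⟪partialDeriv I i (partialDeriv I j X) y, N y⟫_ℝ := by
  rw [eventually_all]
  intro i
  rw [eventually_all]
  intro j
  filter_upwards [partialDeriv_eventuallyEq (h.normal.mono fun y hy => hy j) i, h.smooth_normal,
    h.smooth, self_mem_nhdsWithin] with y h1 h2 h3 hy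
  rw [partialDeriv_inner hy (h2.differentiableWithinAt (by simp))
    (h3.differentiable_partialDeriv hy j), partialDeriv_const, real_inner_comm _ (N y)] at h1
  linarith

lemma eventually_secondFundamentalForm_symm :
    ∀ᶠ y in 𝓝[range I] x, ∀ i j, ⟪partialDeriv I i N y, partialDeriv I j X y⟫_ℝ
      = ⟪partialDeriv I j N y, partialDeriv I i X y⟫_ℝ := by
  filter_upwards [h.eventually_secondFundamentalForm_eq, h.smooth, self_mem_nhdsWithin]
    with y h1 h2 hy i j
  rw [h1, h1, partialDeriv_comm hy h2]

lemma inner_partialDeriv_partialDeriv_normal (i j : Fin n) :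
    ⟪partialDeriv I i (partialDeriv I j N) x, N x⟫_ℝ
      = -⟪partialDeriv I i N x, partialDeriv I j N x⟫_ℝ := by
  have h1 := partialDeriv_congr h.mem_range
    (h.eventually_inner_partialDeriv_normal.mono fun y hy => hy j) i
  rw [partialDeriv_inner h.mem_range (h.smoothAt_normal.differentiable_partialDeriv h.mem_range j)
    (h.smoothAt_normal.differentiableWithinAt (by simp)), partialDeriv_const] at h1
  rw [real_inner_comm]
  rw [real_inner_comm] at h1
  linarith [real_inner_comm (partialDeriv I i N x) (partialDeriv I j N x)]

/-- The Codazzi equation. -/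
lemma codazzi (i j m : Fin n) :
    ⟪partialDeriv I i (partialDeriv I j N) x, partialDeriv I m X x⟫_ℝ
        + ⟪partialDeriv I j N x, partialDeriv I i (partialDeriv I m X) x⟫_ℝ
      = ⟪partialDeriv I i (partialDeriv I m N) x, partialDeriv I j X x⟫_ℝ
        + ⟪partialDeriv I m N x, partialDeriv I i (partialDeriv I j X) x⟫_ℝ := by
  -- Codazzi is the i-th derivative of the symmetry of h in j and m.
  have h1 := partialDeriv_congr h.mem_range
    (h.eventually_secondFundamentalForm_symm.mono fun y hy => hy j m) i
  have hN := h.smoothAt_normal.differentiable_partialDeriv h.mem_range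
  have hX := h.smoothAt.differentiable_partialDeriv h.mem_range
  rwa [partialDeriv_inner h.mem_range (hN _) (hX _),
    partialDeriv_inner h.mem_range (hN _) (hX _)] at h1

lemma partialDeriv_metric (i a b : Fin n) :
    partialDeriv I i (fun y => metric I X y a b) x
      = ⟪partialDeriv I i (partialDeriv I a X) x, partialDeriv I b X x⟫_ℝ
        + ⟪partialDeriv I a X x, partialDeriv I i (partialDeriv I b X) x⟫_ℝ := by
  have hX := h.smoothAt.differentiable_partialDeriv h.mem_range
  exact partialDeriv_inner h.mem_range (hX a) (hX b) i

/-- Inserting the derivatives of g into the Koszul combination, all but twice ⟨∂ᵢ∂ⱼX, ∂ₗX⟩ cancels.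
-/
lemma christoffel_eq (k i j : Fin n) :
    christoffel I X k i j x = ∑ l, (metric I X x)⁻¹ k l *
      ⟪partialDeriv I i (partialDeriv I j X) x, partialDeriv I l X x⟫_ℝ := by
  rw [christoffel, Finset.mul_sum]
  refine Finset.sum_congr rfl fun l _ => ?_
  simp only [h.partialDeriv_metric]
  rw [partialDeriv_comm h.mem_range h.smoothAt j i, partialDeriv_comm h.mem_range h.smoothAt l i,
    partialDeriv_comm h.mem_range h.smoothAt l j,
    real_inner_comm (partialDeriv I i (partialDeriv I l X) x) (partialDeriv I j X x),
    real_inner_comm (partialDeriv I j (partialDeriv I l X) x) (partialDeriv I i X x)]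
  rw [real_inner_comm (partialDeriv I j X x), real_inner_comm (partialDeriv I i X x)]
  ring

lemma det_metric_ne_zero : (metric I X x).det ≠ 0 :=
  det_gram_ne_zero_iff_linearIndependent.mpr h.linearIndependent

lemma differentiable_metric (i j : Fin n) :
    DifferentiableWithinAt ℝ (fun y => metric I X y i j) (range I) x :=
  (h.smoothAt.differentiable_partialDeriv h.mem_range i).inner ℝ
    (h.smoothAt.differentiable_partialDeriv h.mem_range j)

lemma differentiable_inv_metric (i j : Fin n) :
    DifferentiableWithinAt ℝ (fun y => (metric I X y)⁻¹ i j) (range I) x :=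
  differentiableWithinAt_inv_matrix h.differentiable_metric h.det_metric_ne_zero i j

lemma differentiable_secondFundamentalForm (i j : Fin n) :
    DifferentiableWithinAt ℝ (fun y => secondFundamentalForm I X N y i j) (range I) x :=
  (h.smoothAt_normal.differentiable_partialDeriv h.mem_range i).inner ℝ
    (h.smoothAt.differentiable_partialDeriv h.mem_range j)

lemma differentiable_patchMeanCurvature :
    DifferentiableWithinAt ℝ (patchMeanCurvature I X N) (range I) x := by
  unfold patchMeanCurvature
  exact DifferentiableWithinAt.fun_sum fun i _ => DifferentiableWithinAt.fun_sum fun j _ =>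
    (h.differentiable_inv_metric i j).mul (h.differentiable_secondFundamentalForm i j)

/-- In the product rule, ∂h supplies the contraction of ∂N with ∂∂X once, and ∂g⁻¹ supplies it with
factor -2, which leaves the minus sign. -/
lemma partialDeriv_patchMeanCurvature (m : Fin n) :
    partialDeriv I m (patchMeanCurvature I X N) x
      = ∑ i, ∑ j, (metric I X x)⁻¹ i j *
        (⟪partialDeriv I i (partialDeriv I m N) x, partialDeriv I j X x⟫_ℝ
          - ⟪partialDeriv I j N x, partialDeriv I i (partialDeriv I m X) x⟫_ℝ) := by
  have hx := h.mem_range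
  have hG := h.differentiable_inv_metric
  have hh := h.differentiable_secondFundamentalForm
  have hN := h.smoothAt_normal.differentiable_partialDeriv hx
  have hX := h.smoothAt.differentiable_partialDeriv hx
  have h1 : partialDeriv I m (patchMeanCurvature I X N) x
      = ∑ i, ∑ j, ((metric I X x)⁻¹ i j
            * partialDeriv I m (fun y => secondFundamentalForm I X N y i j) x
          + partialDeriv I m (fun y => (metric I X y)⁻¹ i j) x
            * secondFundamentalForm I X N x i j) := by
    have hGh : ∀ i j, DifferentiableWithinAt ℝ
        (fun y => (metric I X y)⁻¹ i j * secondFundamentalForm I X N y i j) (range I) x :=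
      fun i j => (hG i j).mul (hh i j)
    unfold patchMeanCurvature
    rw [partialDeriv_sum hx fun i _ => DifferentiableWithinAt.fun_sum fun j _ => hGh i j]
    refine Finset.sum_congr rfl fun i _ => ?_
    rw [partialDeriv_sum hx fun j _ => hGh i j]
    exact Finset.sum_congr rfl fun j _ => partialDeriv_mul hx (hG i j) (hh i j) m
  have h2 : ∀ i j, partialDeriv I m (fun y => secondFundamentalForm I X N y i j) x
      = ⟪partialDeriv I i (partialDeriv I m N) x, partialDeriv I j X x⟫_ℝ
        + ⟪partialDeriv I i N x, partialDeriv I m (partialDeriv I j X) x⟫_ℝ := by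
    intro i j
    rw [partialDeriv_comm hx h.smoothAt_normal i m]
    exact partialDeriv_inner hx (hN i) (hX j) m
  have h3 := contracted_inv_gram_variation (by simp) h.linearIndependent
    (h.inner_self.self_of_nhdsWithin hx) (h.normal.self_of_nhdsWithin hx)
    (h.eventually_inner_partialDeriv_normal.self_of_nhdsWithin hx)
    (h.eventually_secondFundamentalForm_symm.self_of_nhdsWithin hx)
    (fun a => partialDeriv I m (partialDeriv I a X) x)
  rw [← metric_eq_gram] at h3
  have h4 : ∑ i, ∑ j, partialDeriv I m (fun y => (metric I X y)⁻¹ i j) x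
            * secondFundamentalForm I X N x i j
      = -(2 * ∑ i, ∑ j, (metric I X x)⁻¹ i j *
          ⟪partialDeriv I j N x, partialDeriv I m (partialDeriv I i X) x⟫_ℝ) := by
    rw [← h3, ← Finset.sum_neg_distrib]
    refine Finset.sum_congr rfl fun i _ => ?_
    rw [← Finset.sum_neg_distrib]
    refine Finset.sum_congr rfl fun j _ => ?_
    rw [partialDeriv_inv_matrix hx h.differentiable_metric h.det_metric_ne_zero, neg_mul]
    simp only [h.partialDeriv_metric]
    rfl
  have h5 : ∑ i, ∑ j, (metric I X x)⁻¹ i j *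
          ⟪partialDeriv I i N x, partialDeriv I m (partialDeriv I j X) x⟫_ℝ
      = ∑ i, ∑ j, (metric I X x)⁻¹ i j *
          ⟪partialDeriv I j N x, partialDeriv I m (partialDeriv I i X) x⟫_ℝ := by
    rw [Finset.sum_comm]
    refine Finset.sum_congr rfl fun i _ => Finset.sum_congr rfl fun j _ => ?_
    rw [metric_eq_gram, inv_gram_symm]
  simp only [h1, h2, Finset.sum_add_distrib, h4, mul_add, h5, mul_sub, Finset.sum_sub_distrib,
    partialDeriv_comm hx h.smoothAt _ m]
  ring

/-- `Δ⟨N, KX⟩ = -|A|² ⟨N, KX⟩ + ⟨∇H, KX⟩` for skew-symmetric `K`. -/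
theorem laplace_support {K : EuclideanSpace ℝ (Fin (n + 1)) →L[ℝ] EuclideanSpace ℝ (Fin (n + 1))}
    (hK : ∀ v w, ⟪v, K w⟫_ℝ = -⟪w, K v⟫_ℝ) :
    ∑ i, ∑ j, (metric I X x)⁻¹ i j *
      (partialDeriv I i (partialDeriv I j fun y => ⟪N y, K (X y)⟫_ℝ) x
        - ∑ k, christoffel I X k i j x * partialDeriv I k (fun y => ⟪N y, K (X y)⟫_ℝ) x)
    = -(∑ i, ∑ j, ∑ k, ∑ l, (metric I X x)⁻¹ i k * (metric I X x)⁻¹ j l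
          * secondFundamentalForm I X N x i j * secondFundamentalForm I X N x k l)
          * ⟪N x, K (X x)⟫_ℝ
      + ∑ a, ∑ b, (metric I X x)⁻¹ a b * partialDeriv I b (patchMeanCurvature I X N) x
          * ⟪K (X x), partialDeriv I a X x⟫_ℝ := by
  have hx := h.mem_range
  have hdN := h.smoothAt_normal.differentiable_partialDeriv hx
  have hdX := h.smoothAt.differentiable_partialDeriv hx
  have hN0 := h.smoothAt_normal.differentiableWithinAt (by simp)
  have hX0 := h.smoothAt.differentiableWithinAt (by simp)
  have hw : ∀ j, partialDeriv I j (fun y => ⟪N y, K (X y)⟫_ℝ) =ᶠ[𝓝[range I] x] fun y =>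
      ⟪partialDeriv I j N y, K (X y)⟫_ℝ + ⟪N y, K (partialDeriv I j X y)⟫_ℝ := by
    intro j
    filter_upwards [h.smooth, h.smooth_normal, self_mem_nhdsWithin] with y h1 h2 hy
    have h1' := h1.differentiableWithinAt (by simp)
    have hKX : DifferentiableWithinAt ℝ (fun y => K (X y)) (range I) y :=
      K.differentiableAt.comp_differentiableWithinAt y h1'
    rw [partialDeriv_inner hy (h2.differentiableWithinAt (by simp)) hKX, partialDeriv_clm_comp hy h1']
  have hww : ∀ i j, partialDeriv I i (partialDeriv I j fun y => ⟪N y, K (X y)⟫_ℝ) x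
      = ⟪partialDeriv I i (partialDeriv I j N) x, K (X x)⟫_ℝ
        + ⟪partialDeriv I j N x, K (partialDeriv I i X x)⟫_ℝ
        + ⟪partialDeriv I i N x, K (partialDeriv I j X x)⟫_ℝ
        + ⟪N x, K (partialDeriv I i (partialDeriv I j X) x)⟫_ℝ := by
    intro i j
    have hKX : DifferentiableWithinAt ℝ (fun y => K (X y)) (range I) x :=
      K.differentiableAt.comp_differentiableWithinAt x hX0
    have hKdX : DifferentiableWithinAt ℝ (fun y => K (partialDeriv I j X y)) (range I) x :=
      K.differentiableAt.comp_differentiableWithinAt x (hdX j)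
    rw [partialDeriv_congr hx (hw j), partialDeriv_add hx ((hdN j).inner ℝ hKX)
      (hN0.inner ℝ hKdX), partialDeriv_inner hx (hdN j) hKX, partialDeriv_inner hx hN0 hKdX,
      partialDeriv_clm_comp hx hX0, partialDeriv_clm_comp hx (hdX j)]
    ring
  simp only [hww, fun k => (hw k).self_of_nhdsWithin hx, h.partialDeriv_patchMeanCurvature]
  exact contracted_hessian_support (by simp) h.linearIndependent
    (h.inner_self.self_of_nhdsWithin hx) (h.normal.self_of_nhdsWithin hx)
    (fun i j => partialDeriv_comm hx h.smoothAt i j)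
    (h.eventually_inner_partialDeriv_normal.self_of_nhdsWithin hx)
    h.inner_partialDeriv_partialDeriv_normal
    (h.eventually_secondFundamentalForm_eq.self_of_nhdsWithin hx) h.codazzi
    h.christoffel_eq hK (K (X x))

/-- A vector `w` orthogonal to `N` with `⟨w, ∂ᵢX⟩ = ∂ᵢH` is the tangential gradient of `H`. -/
lemma inner_eq_gradient_sum {w : EuclideanSpace ℝ (Fin (n + 1))} (hw : ⟪w, N x⟫_ℝ = 0)
    (Y : EuclideanSpace ℝ (Fin (n + 1))) :
    ⟪w, Y⟫_ℝ = ∑ a, ∑ b, (metric I X x)⁻¹ a b * ⟪w, partialDeriv I b X x⟫_ℝ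
          * ⟪Y, partialDeriv I a X x⟫_ℝ := by
  rw [inner_eq_frame_sum (by simp) h.linearIndependent
    (h.inner_self.self_of_nhdsWithin h.mem_range) (h.normal.self_of_nhdsWithin h.mem_range) w Y,
    hw, zero_mul, zero_add]
  rfl

end

end IsNormalPatchAt

end Patch

/-! ### Interchanging time and space derivatives on `range I ×ˢ J`. -/

section SpaceTime

open Filter Topology

variable {n : ℕ} {H : Type*} [TopologicalSpace H]
  {I : ModelWithCorners ℝ (EuclideanSpace ℝ (Fin n)) H}
  {V : Type*} [NormedAddCommGroup V] [NormedSpace ℝ V]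
  {J : Set ℝ} {Φ : EuclideanSpace ℝ (Fin n) × ℝ → V} {x : EuclideanSpace ℝ (Fin n)} {t : ℝ}

lemma _root_.Set.OrdConnected.interior_nonempty_of_nontrivial {J : Set ℝ} (hJ : J.OrdConnected)
    (hJ' : J.Nontrivial) : (interior J).Nonempty := by
  obtain ⟨a, ha, b, hb, hab⟩ := hJ'.exists_lt
  have h := interior_mono (hJ.out ha hb)
  rw [interior_Icc] at h
  exact (nonempty_Ioo.mpr hab).mono h

lemma uniqueDiffOn_range_prod (I : ModelWithCorners ℝ (EuclideanSpace ℝ (Fin n)) H)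
    (hJ : J.OrdConnected) (hJ' : J.Nontrivial) : UniqueDiffOn ℝ (range I ×ˢ J) :=
  I.uniqueDiffOn.prod
    (uniqueDiffOn_convex hJ.convex (hJ.interior_nonempty_of_nontrivial hJ'))

lemma hasFDerivWithinAt_slice (ht : t ∈ J)
    (hΦ : DifferentiableWithinAt ℝ Φ (range I ×ˢ J) (x, t)) :
    HasFDerivWithinAt (fun y => Φ (y, t)) ((fderivWithin ℝ Φ (range I ×ˢ J) (x, t)).comp
      (ContinuousLinearMap.inl ℝ _ ℝ)) (range I) x :=
  hΦ.hasFDerivWithinAt.comp (t := range I ×ˢ J) x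
    (hasFDerivAt_prodMk_left x t).hasFDerivWithinAt (fun _ hy => ⟨hy, ht⟩)

lemma partialDeriv_slice (hx : x ∈ range I) (ht : t ∈ J)
    (hΦ : DifferentiableWithinAt ℝ Φ (range I ×ˢ J) (x, t)) (i : Fin n) :
    partialDeriv I i (fun y => Φ (y, t)) x
      = fderivWithin ℝ Φ (range I ×ˢ J) (x, t) (EuclideanSpace.single i 1, 0) := by
  rw [partialDeriv, (hasFDerivWithinAt_slice ht hΦ).fderivWithin (I.uniqueDiffOn x hx)]
  rfl

lemma hasDerivWithinAt_slice (hx : x ∈ range I)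
    (hΦ : DifferentiableWithinAt ℝ Φ (range I ×ˢ J) (x, t)) :
    HasDerivWithinAt (fun τ => Φ (x, τ)) (fderivWithin ℝ Φ (range I ×ˢ J) (x, t) (0, 1)) J t := by
  have h := (hΦ.hasFDerivWithinAt.comp (t := range I ×ˢ J) t
    (hasFDerivAt_prodMk_right x t).hasFDerivWithinAt
    (fun y hy => ⟨hx, hy⟩)).hasDerivWithinAt
  exact h

/-- Time derivatives commute with partial derivatives in space. -/
lemma hasDerivWithinAt_partialDeriv (hJ : J.OrdConnected) (hJ' : J.Nontrivial)
    (hx : x ∈ range I) (ht : t ∈ J)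
    (hΦ : ∀ᶠ y in 𝓝[range I] x, ∀ τ ∈ J, ContDiffWithinAt ℝ ∞ Φ (range I ×ˢ J) (y, τ))
    {Ψ : EuclideanSpace ℝ (Fin n) → V}
    (hΨ : ∀ᶠ y in 𝓝[range I] x, HasDerivWithinAt (fun τ => Φ (y, τ)) (Ψ y) J t) (i : Fin n) :
    HasDerivWithinAt (fun τ => partialDeriv I i (fun y => Φ (y, τ)) x)
      (partialDeriv I i Ψ x) J t := by
  have hu := uniqueDiffOn_range_prod I hJ hJ'
  have huJ : UniqueDiffOn ℝ J :=
    uniqueDiffOn_convex hJ.convex (hJ.interior_nonempty_of_nontrivial hJ')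
  have hx' := hΦ.self_of_nhdsWithin hx
  have hmem : (x, t) ∈ range I ×ˢ J := ⟨hx, ht⟩
  -- Second derivatives are symmetric at boundary points and endpoints only through approximation by
  -- interior points; nondegeneracy of J enters here.
  have hcl : (x, t) ∈ closure (interior (range I ×ˢ J)) := by
    rw [interior_prod_eq, closure_prod_eq]
    refine ⟨I.range_subset_closure_interior hx, ?_⟩
    rw [(hJ.convex (𝕜 := ℝ)).closure_interior_eq_closure_of_nonempty_interior
      (hJ.interior_nonempty_of_nontrivial hJ')]
    exact subset_closure ht
  have hd : DifferentiableWithinAt ℝ (fderivWithin ℝ Φ (range I ×ˢ J)) (range I ×ˢ J) (x, t) :=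
    ((hx' t ht).fderivWithin_right hu (m := ∞) (by simp) hmem).differentiableWithinAt (by simp)
  have hsymm : IsSymmSndFDerivWithinAt ℝ Φ (range I ×ˢ J) (x, t) :=
    (hx' t ht).isSymmSndFDerivWithinAt
      (by simpa using WithTop.coe_le_coe.mpr (le_top : (2 : ℕ∞) ≤ ⊤)) hu hcl hmem
  have hs : ∀ {y τ}, ContDiffWithinAt ℝ ∞ Φ (range I ×ˢ J) (y, τ) →
      DifferentiableWithinAt ℝ Φ (range I ×ˢ J) (y, τ) := fun h =>
    h.differentiableWithinAt (by simp)
  -- Uniqueness of one-sided time derivatives identifies Ψ with the (0, 1) component of the full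
  -- derivative of Φ.
  have hΨ' : Ψ =ᶠ[𝓝[range I] x]
      fun y => fderivWithin ℝ Φ (range I ×ˢ J) (y, t) (0, 1) := by
    filter_upwards [hΦ, hΨ, self_mem_nhdsWithin] with y h1 h2 hy
    exact (huJ t ht).eq_deriv _ h2 (hasDerivWithinAt_slice hy (hs (h1 t ht)))
  have h1 : partialDeriv I i Ψ x = fderivWithin ℝ (fderivWithin ℝ Φ (range I ×ˢ J))
      (range I ×ˢ J) (x, t) (EuclideanSpace.single i 1, 0) (0, 1) := by
    rw [partialDeriv_congr hx hΨ']
    exact (partialDeriv_clm_comp hx (hasFDerivWithinAt_slice ht hd).differentiableWithinAt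
      (ContinuousLinearMap.apply ℝ V ((0, 1) : EuclideanSpace ℝ (Fin n) × ℝ)) i).trans
      (congrArg (fun L => L (0, 1)) (partialDeriv_slice hx ht hd i))
  have h2 := (hasDerivWithinAt_slice hx hd).clm_apply
    (hasDerivWithinAt_const t J ((EuclideanSpace.single i 1, 0) : EuclideanSpace ℝ (Fin n) × ℝ))
  rw [map_zero, add_zero] at h2
  rw [h1, hsymm]
  refine h2.congr (fun τ hτ => ?_) ?_
  · exact partialDeriv_slice hx hτ (hs (hx' τ hτ)) i
  · exact partialDeriv_slice hx ht (hs (hx' t ht)) i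

end SpaceTime

/-! ### Chart independence of the mean curvature, and smoothness in charts. -/

section Invariance

open Filter Topology

variable {n : ℕ} {H : Type*} [TopologicalSpace H]
  {I : ModelWithCorners ℝ (EuclideanSpace ℝ (Fin n)) H}
  {M : Type*} [TopologicalSpace M] [ChartedSpace H M]

/-- Both g and h transform as Tᵀ(·)T, so g⁻¹hᵀ is conjugated by T and its trace is unchanged. -/
lemma patchMeanCurvature_eq_of_transform
    {X N X' N' : EuclideanSpace ℝ (Fin n) → EuclideanSpace ℝ (Fin (n + 1))}
    {x x' : EuclideanSpace ℝ (Fin n)} {T : Matrix (Fin n) (Fin n) ℝ} (hT : IsUnit T.det)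
    (hX : ∀ i, partialDeriv I i X x = ∑ a, T a i • partialDeriv I a X' x')
    (hN : ∀ i, partialDeriv I i N x = ∑ a, T a i • partialDeriv I a N' x') :
    patchMeanCurvature I X N x = patchMeanCurvature I X' N' x' := by
  have htr : ∀ X N x, patchMeanCurvature I X N x
      = ((metric I X x)⁻¹ * (secondFundamentalForm I X N x)ᵀ).trace := fun X N x => rfl
  have hg : metric I X x = Tᵀ * (metric I X' x' * T) := by
    ext i j
    simp only [metric, hX, mul_apply, of_apply, transpose_apply, sum_inner, inner_sum,
      inner_smul_left, inner_smul_right, conj_trivial, Finset.mul_sum]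
    rw [Finset.sum_comm]
    refine Finset.sum_congr rfl fun a _ => Finset.sum_congr rfl fun b _ => by ring
  have hh : secondFundamentalForm I X N x = Tᵀ * (secondFundamentalForm I X' N' x' * T) := by
    ext i j
    simp only [secondFundamentalForm, hX, hN, mul_apply, of_apply, transpose_apply, sum_inner,
      inner_sum, inner_smul_left, inner_smul_right, conj_trivial, Finset.mul_sum]
    rw [Finset.sum_comm]
    refine Finset.sum_congr rfl fun a _ => Finset.sum_congr rfl fun b _ => by ring
  have hT' : IsUnit Tᵀ.det := by rwa [det_transpose]
  rw [htr, htr, hg, hh]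
  simp only [Matrix.mul_inv_rev, transpose_mul, transpose_transpose, Matrix.mul_assoc]
  rw [nonsing_inv_mul_cancel_left _ _ hT', trace_mul_comm]
  simp only [Matrix.mul_assoc, mul_nonsing_inv _ hT, mul_one]

lemma eq_sum_single (v : EuclideanSpace ℝ (Fin n)) :
    v = ∑ a, v a • EuclideanSpace.single a (1 : ℝ) := by
  ext b
  simp [Pi.single_apply]

lemma partialDeriv_inCoords_self {f : M → EuclideanSpace ℝ (Fin (n + 1))}
    (hf : MDifferentiable I 𝓘(ℝ, EuclideanSpace ℝ (Fin (n + 1))) f) (p : M) (i : Fin n) :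
    partialDeriv I i (inCoords I p f) (extChartAt I p p)
      = mfderiv I 𝓘(ℝ, EuclideanSpace ℝ (Fin (n + 1))) f p (EuclideanSpace.single i (1 : ℝ)) := by
  exact (congrArg (fun L => L (EuclideanSpace.single i (1 : ℝ))) (hf p).mfderiv).symm

variable [IsManifold I ∞ M]

lemma partialDeriv_inCoords {f : M → EuclideanSpace ℝ (Fin (n + 1))}
    (hf : MDifferentiable I 𝓘(ℝ, EuclideanSpace ℝ (Fin (n + 1))) f) (p : M)
    {x : EuclideanSpace ℝ (Fin n)} (hx : x ∈ (extChartAt I p).target) (i : Fin n) :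
    partialDeriv I i (inCoords I p f) x
      = mfderiv I 𝓘(ℝ, EuclideanSpace ℝ (Fin (n + 1))) f ((extChartAt I p).symm x)
        (mfderivWithin 𝓘(ℝ, EuclideanSpace ℝ (Fin n)) I (extChartAt I p).symm (range I) x
          (EuclideanSpace.single i (1 : ℝ))) := by
  have : IsManifold I 1 M := IsManifold.of_le (n := ∞) (by simp)
  have h := mfderiv_comp_mfderivWithin x (hf _) (mdifferentiableWithinAt_extChartAt_symm hx)
    (I.uniqueDiffOn x (extChartAt_target_subset_range p hx)).uniqueMDiffWithinAt
  rw [mfderivWithin_eq_fderivWithin] at h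
  exact congrArg (fun L => L (EuclideanSpace.single i (1 : ℝ))) h

/-- The mean curvature can be computed in any chart. -/
lemma meanCurvature_eq_patchMeanCurvature {f ν : M → EuclideanSpace ℝ (Fin (n + 1))}
    (hf : MDifferentiable I 𝓘(ℝ, EuclideanSpace ℝ (Fin (n + 1))) f)
    (hν : MDifferentiable I 𝓘(ℝ, EuclideanSpace ℝ (Fin (n + 1))) ν) (p : M)
    {x : EuclideanSpace ℝ (Fin n)} (hx : x ∈ (extChartAt I p).target) :
    meanCurvature I f ν ((extChartAt I p).symm x)
      = patchMeanCurvature I (inCoords I p f) (inCoords I p ν) x := by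
  have : IsManifold I 1 M := IsManifold.of_le (n := ∞) (by simp)
  obtain ⟨e, he⟩ := isInvertible_mfderivWithin_extChartAt_symm (I := I) (x := p) hx
  -- Tangent spaces are copies of the model space, so the derivative of the inverse chart is an
  -- automorphism of ℝⁿ; its matrix T is the Jacobian between the two charts.
  let e' : EuclideanSpace ℝ (Fin n) ≃L[ℝ] EuclideanSpace ℝ (Fin n) := e
  let T : Matrix (Fin n) (Fin n) ℝ := Matrix.of fun a i => e' (EuclideanSpace.single i 1) a
  let S : Matrix (Fin n) (Fin n) ℝ := Matrix.of fun a i => e'.symm (EuclideanSpace.single i 1) a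
  have hTS : T * S = 1 := by
    ext i j
    have h := congrArg e' (eq_sum_single (e'.symm (EuclideanSpace.single j 1)))
    rw [e'.apply_symm_apply, map_sum] at h
    have h2 := congrArg (fun v : EuclideanSpace ℝ (Fin n) => v i) h
    simp only [map_smul, WithLp.ofLp_sum, Finset.sum_apply, PiLp.smul_apply, smul_eq_mul] at h2
    simp only [T, S, mul_apply, of_apply]
    rw [one_apply]
    simp only [mul_comm (e' _ _)]
    rw [← h2]
    simp
  have hT : IsUnit T.det := isUnit_det_of_right_inverse hTS
  have key : ∀ {f : M → EuclideanSpace ℝ (Fin (n + 1))},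
      MDifferentiable I 𝓘(ℝ, EuclideanSpace ℝ (Fin (n + 1))) f → ∀ i,
      partialDeriv I i (inCoords I p f) x = ∑ a, T a i •
        partialDeriv I a (inCoords I ((extChartAt I p).symm x) f)
          (extChartAt I ((extChartAt I p).symm x) ((extChartAt I p).symm x)) := by
    intro f hf i
    simp only [partialDeriv_inCoords_self hf]
    rw [partialDeriv_inCoords hf p hx, ← he]
    set L : EuclideanSpace ℝ (Fin n) →L[ℝ] EuclideanSpace ℝ (Fin (n + 1)) :=
      mfderiv I 𝓘(ℝ, EuclideanSpace ℝ (Fin (n + 1))) f ((extChartAt I p).symm x)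
    change L (e' (EuclideanSpace.single i 1)) = ∑ a, T a i • L (EuclideanSpace.single a 1)
    conv_lhs => rw [eq_sum_single (e' (EuclideanSpace.single i 1)), map_sum]
    simp only [map_smul]
    rfl
  exact (patchMeanCurvature_eq_of_transform hT (key hf) (key hν)).symm

lemma contDiffWithinAt_inCoords {f : M → EuclideanSpace ℝ (Fin (n + 1))}
    (hf : ContMDiff I 𝓘(ℝ, EuclideanSpace ℝ (Fin (n + 1))) ∞ f) (p : M)
    {x : EuclideanSpace ℝ (Fin n)} (hx : x ∈ (extChartAt I p).target) :
    ContDiffWithinAt ℝ ∞ (inCoords I p f) (range I) x := by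
  have h : ContDiffOn ℝ ∞ (inCoords I p f) (extChartAt I p).target :=
    (hf.comp_contMDiffOn (contMDiffOn_extChartAt_symm p)).contDiffOn
  exact (h x hx).mono_of_mem_nhdsWithin (extChartAt_target_mem_nhdsWithin_of_mem hx)

lemma contDiffWithinAt_inCoords_prod {J : Set ℝ} {F : ℝ → M → EuclideanSpace ℝ (Fin (n + 1))}
    (hF : ContMDiffOn (I.prod 𝓘(ℝ, ℝ)) 𝓘(ℝ, EuclideanSpace ℝ (Fin (n + 1))) ∞
      (fun q : M × ℝ => F q.2 q.1) (univ ×ˢ J)) (p : M)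
    {x : EuclideanSpace ℝ (Fin n)} (hx : x ∈ (extChartAt I p).target) {t : ℝ} (ht : t ∈ J) :
    ContDiffWithinAt ℝ ∞ (fun z : EuclideanSpace ℝ (Fin n) × ℝ => inCoords I p (F z.2) z.1)
      (range I ×ˢ J) (x, t) := by
  have h1 : ContMDiffOn (𝓘(ℝ, EuclideanSpace ℝ (Fin n)).prod 𝓘(ℝ, ℝ)) (I.prod 𝓘(ℝ, ℝ)) ∞
      (Prod.map (extChartAt I p).symm id) ((extChartAt I p).target ×ˢ J) :=
    (contMDiffOn_extChartAt_symm p).prodMap contMDiffOn_id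
  have h2 := hF.comp h1 (fun z hz => ⟨mem_univ _, hz.2⟩)
  rw [← modelWithCornersSelf_prod, chartedSpaceSelf_prod] at h2
  have h3 := h2.contDiffOn (x, t) ⟨hx, ht⟩
  refine h3.mono_of_mem_nhdsWithin ?_
  rw [nhdsWithin_prod_eq]
  exact prod_mem_prod (extChartAt_target_mem_nhdsWithin_of_mem hx) self_mem_nhdsWithin

end Invariance

/-! ### Killing fields and evolution along the flow. -/

section Flow

open Filter Topology

variable {n : ℕ}

/-- The rotational Killing field as a continuous linear map. -/
def killingCLM (i : Fin n) :
    EuclideanSpace ℝ (Fin (n + 1)) →L[ℝ] EuclideanSpace ℝ (Fin (n + 1)) :=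
  (EuclideanSpace.proj (Fin.last n) : EuclideanSpace ℝ (Fin (n + 1)) →L[ℝ] ℝ).smulRight
      (EuclideanSpace.single i.castSucc (1 : ℝ))
    - (EuclideanSpace.proj i.castSucc : EuclideanSpace ℝ (Fin (n + 1)) →L[ℝ] ℝ).smulRight
      (EuclideanSpace.single (Fin.last n) (1 : ℝ))

lemma killingCLM_apply (i : Fin n) (x : EuclideanSpace ℝ (Fin (n + 1))) :
    killingCLM i x = killing i x := rfl

lemma inner_killingCLM (i : Fin n) (v w : EuclideanSpace ℝ (Fin (n + 1))) :
    ⟪v, killingCLM i w⟫_ℝ = -⟪w, killingCLM i v⟫_ℝ := by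
  simp only [killingCLM_apply, killing, inner_sub_right, inner_smul_right,
    EuclideanSpace.inner_single_right, conj_trivial]
  ring

variable {H : Type*} [TopologicalSpace H]
  {I : ModelWithCorners ℝ (EuclideanSpace ℝ (Fin n)) H}
  {M : Type*} [TopologicalSpace M] [ChartedSpace H M]
  {J : Set ℝ} {F ν : ℝ → M → EuclideanSpace ℝ (Fin (n + 1))} {t : ℝ}

namespace IsMeanCurvatureFlow

lemma contMDiff_slice {f : ℝ → M → EuclideanSpace ℝ (Fin (n + 1))}
    (hf : ContMDiffOn (I.prod 𝓘(ℝ, ℝ)) 𝓘(ℝ, EuclideanSpace ℝ (Fin (n + 1))) ∞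
      (fun q : M × ℝ => f q.2 q.1) (univ ×ˢ J)) (ht : t ∈ J) :
    ContMDiff I 𝓘(ℝ, EuclideanSpace ℝ (Fin (n + 1))) ∞ (f t) :=
  hf.comp_contMDiff (contMDiff_id.prodMk contMDiff_const) fun q => ⟨mem_univ q, ht⟩

variable [IsManifold I ∞ M] (hF : IsMeanCurvatureFlow I J F ν)
include hF

lemma isNormalPatchAt (ht : t ∈ J) (p : M) :
    IsNormalPatchAt I (inCoords I p (F t)) (inCoords I p (ν t)) (extChartAt I p p) := by
  have hFt := contMDiff_slice hF.smooth ht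
  have hνt := contMDiff_slice hF.smooth_normal ht
  have hdF : MDifferentiable I 𝓘(ℝ, EuclideanSpace ℝ (Fin (n + 1))) (F t) :=
    hFt.mdifferentiable (by simp)
  have htar := extChartAt_target_mem_nhdsWithin (I := I) p
  refine ⟨extChartAt_target_subset_range p (mem_extChartAt_target p), ?_, ?_, ?_, ?_, ?_⟩
  · filter_upwards [htar] with y hy using contDiffWithinAt_inCoords hFt p hy
  · filter_upwards [htar] with y hy using contDiffWithinAt_inCoords hνt p hy
  · refine Eventually.of_forall fun y => ?_
    rw [real_inner_self_eq_norm_sq, inCoords, Function.comp_apply, hF.norm_normal t ht, one_pow]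
  · filter_upwards [htar] with y hy i
    rw [partialDeriv_inCoords hdF p hy]
    exact hF.normal t ht _ _
  · have hli : LinearIndependent ℝ fun i : Fin n => EuclideanSpace.single i (1 : ℝ) := by
      have h := (EuclideanSpace.basisFun (Fin n) ℝ).orthonormal.linearIndependent
      rwa [show ⇑(EuclideanSpace.basisFun (Fin n) ℝ) = fun i => EuclideanSpace.single i 1 from
        funext fun i => EuclideanSpace.basisFun_apply _ _ i] at h
    simp only [partialDeriv_inCoords_self hdF]
    let L : EuclideanSpace ℝ (Fin n) →L[ℝ] EuclideanSpace ℝ (Fin (n + 1)) :=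
      mfderiv I 𝓘(ℝ, EuclideanSpace ℝ (Fin (n + 1))) (F t) p
    exact hli.map' L.toLinearMap (LinearMap.ker_eq_bot.mpr (hF.immersion t ht p))

/-- In any chart the position vector satisfies `∂ₜX = -H N`. -/
lemma hasDerivWithinAt_inCoords (ht : t ∈ J) (p : M) {x : EuclideanSpace ℝ (Fin n)}
    (hx : x ∈ (extChartAt I p).target) :
    HasDerivWithinAt (fun τ => inCoords I p (F τ) x)
      (-(patchMeanCurvature I (inCoords I p (F t)) (inCoords I p (ν t)) x
        • inCoords I p (ν t) x)) J t := by
  have hFt := contMDiff_slice hF.smooth ht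
  have hνt := contMDiff_slice hF.smooth_normal ht
  have h := hF.flow t ht ((extChartAt I p).symm x)
  rwa [meanCurvature_eq_patchMeanCurvature (hFt.mdifferentiable (by simp))
    (hνt.mdifferentiable (by simp)) p hx] at h

/-- The normal evolves by `∂ₜν = ∇H`. -/
lemma hasDerivWithinAt_normal (hJ : J.OrdConnected) (hJ' : J.Nontrivial) (ht : t ∈ J) (p : M) :
    ∃ w, HasDerivWithinAt (fun τ => ν τ p) w J t ∧ ⟪w, ν t p⟫_ℝ = 0 ∧
      ∀ i, ⟪w, partialDeriv I i (inCoords I p (F t)) (extChartAt I p p)⟫_ℝ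
        = partialDeriv I i (patchMeanCurvature I (inCoords I p (F t)) (inCoords I p (ν t)))
            (extChartAt I p p) := by
  have hpatch := hF.isNormalPatchAt ht p
  have hx := hpatch.mem_range
  have htar := extChartAt_target_mem_nhdsWithin (I := I) p
  have huJ : UniqueDiffOn ℝ J :=
    uniqueDiffOn_convex hJ.convex (hJ.interior_nonempty_of_nontrivial hJ')
  have hcoord : ∀ τ, inCoords I p (ν τ) (extChartAt I p p) = ν τ p := fun τ => by
    rw [inCoords, Function.comp_apply, extChartAt_to_inv]
  have hw := hasDerivWithinAt_slice hx ((contDiffWithinAt_inCoords_prod hF.smooth_normal p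
    (mem_extChartAt_target p) ht).differentiableWithinAt (by simp))
  simp only [hcoord] at hw
  refine ⟨_, hw, ?_, fun i => ?_⟩
  · have h1 : HasDerivWithinAt (fun τ => ⟪ν τ p, ν τ p⟫_ℝ) 0 J t :=
      (hasDerivWithinAt_const t J (1 : ℝ)).congr_of_mem
        (fun τ hτ => by rw [real_inner_self_eq_norm_sq, hF.norm_normal τ hτ, one_pow]) ht
    have h2 := (huJ t ht).eq_deriv _ (hw.inner ℝ hw) h1
    rw [real_inner_comm] at h2
    linarith
  -- This gives ∂ₜ∂ᵢX = ∂ᵢ(-HN). Paired with N it reduces to -∂ᵢH, since |N| = 1 and ∂ᵢN ⊥ N.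
  · have hX := hasDerivWithinAt_partialDeriv hJ hJ' hx ht
      (Φ := fun z => inCoords I p (F z.2) z.1)
      (by filter_upwards [htar] with y hy τ hτ using
        contDiffWithinAt_inCoords_prod hF.smooth p hy hτ)
      (by filter_upwards [htar] with y hy using hF.hasDerivWithinAt_inCoords ht p hy) i
    have h1 : HasDerivWithinAt (fun τ => ⟪ν τ p,
        partialDeriv I i (inCoords I p (F τ)) (extChartAt I p p)⟫_ℝ) 0 J t := by
      refine (hasDerivWithinAt_const t J (0 : ℝ)).congr_of_mem (fun τ hτ => ?_) ht
      have h := hF.isNormalPatchAt hτ p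
      rw [← hcoord τ]
      exact h.normal.self_of_nhdsWithin h.mem_range i
    have h2 := (huJ t ht).eq_deriv _ (hw.inner ℝ hX) h1
    have hN := hpatch.smoothAt_normal.differentiableWithinAt (n := ∞) (by simp)
    have h3 : partialDeriv I i (fun y => -(patchMeanCurvature I (inCoords I p (F t))
          (inCoords I p (ν t)) y • inCoords I p (ν t) y)) (extChartAt I p p)
        = -partialDeriv I i (fun y => patchMeanCurvature I (inCoords I p (F t))
          (inCoords I p (ν t)) y • inCoords I p (ν t) y) (extChartAt I p p) :=
      partialDeriv_clm_comp hx (hpatch.differentiable_patchMeanCurvature.smul hN)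
        (-ContinuousLinearMap.id ℝ _) i
    have h4 := hpatch.eventually_inner_partialDeriv_normal.self_of_nhdsWithin hx i
    rw [real_inner_comm, hcoord] at h4
    rw [h3, partialDeriv_smul hx hpatch.differentiable_patchMeanCurvature hN, inner_neg_right,
      inner_add_right, inner_smul_right, inner_smul_right, h4, hcoord,
      real_inner_self_eq_norm_sq, hF.norm_normal t ht] at h2
    linarith

end IsMeanCurvatureFlow

end Flow
end MCF

end

/-! ### The evolution equation. -/

theorem mainTheorem7 {n : ℕ} {H : Type*} [TopologicalSpace H]
    (I : ModelWithCorners ℝ (EuclideanSpace ℝ (Fin n)) H)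
    {M : Type*} [TopologicalSpace M] [ChartedSpace H M] [IsManifold I ∞ M]
    (J : Set ℝ) (hJ : J.OrdConnected) (hJ' : J.Nontrivial)
    (F ν : ℝ → M → EuclideanSpace ℝ (Fin (n + 1)))
    (hF : MCF.IsMeanCurvatureFlow I J F ν)
    (i : Fin n) (t : ℝ) (ht : t ∈ J) (p : M) :
    DifferentiableWithinAt ℝ (fun τ => MCF.killingSupport i (F τ) (ν τ) p) J t ∧
    derivWithin (fun τ => MCF.killingSupport i (F τ) (ν τ) p) J t
      - MCF.laplaceBeltrami I (F t) (MCF.killingSupport i (F t) (ν t)) p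
      = MCF.normSqSecondFundamentalForm I (F t) (ν t) p
          * MCF.killingSupport i (F t) (ν t) p := by
  obtain ⟨w, hw, hwν, hwX⟩ := hF.hasDerivWithinAt_normal hJ hJ' ht p
  have hpatch := hF.isNormalPatchAt ht p
  have hcoord : ∀ f : M → EuclideanSpace ℝ (Fin (n + 1)),
      MCF.inCoords I p f (extChartAt I p p) = f p := fun f => by
    rw [MCF.inCoords, Function.comp_apply, extChartAt_to_inv]
  have hskew : ⟪ν t p, MCF.killingCLM i (ν t p)⟫_ℝ = 0 := by
    linarith [MCF.inner_killingCLM i (ν t p) (ν t p)]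
  have hd : HasDerivWithinAt (fun τ => MCF.killingSupport i (F τ) (ν τ) p)
      ⟪w, MCF.killingCLM i (F t p)⟫_ℝ J t := by
    have h := hw.inner ℝ ((MCF.killingCLM i).hasFDerivAt.comp_hasDerivWithinAt t (hF.flow t ht p))
    rw [map_neg, map_smul, inner_neg_right, inner_smul_right, hskew, mul_zero, neg_zero,
      zero_add] at h
    exact h
  have huJ : UniqueDiffWithinAt ℝ J t :=
    uniqueDiffOn_convex hJ.convex (hJ.interior_nonempty_of_nontrivial hJ') t ht
  refine ⟨hd.differentiableWithinAt, ?_⟩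
  have hlap := hpatch.laplace_support (MCF.inner_killingCLM i)
  have hgrad := hpatch.inner_eq_gradient_sum (w := w) (by rwa [hcoord])
    (MCF.killingCLM i (F t p))
  -- Since w = ∂ₜν is the tangential gradient of H, the gradient sum in `hlap` is exactly the time
  -- derivative found in `hd`.
  simp only [hwX] at hgrad
  simp only [hcoord] at hlap
  rw [← hgrad] at hlap
  rw [hd.derivWithin huJ]
  have hlap' : MCF.laplaceBeltrami I (F t) (MCF.killingSupport i (F t) (ν t)) p
      = -(MCF.normSqSecondFundamentalForm I (F t) (ν t) p)
          * MCF.killingSupport i (F t) (ν t) p + ⟪w, MCF.killingCLM i (F t p)⟫_ℝ := hlap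
  rw [hlap']
  ring
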